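/- Throughout, $E$ is a real Banach space of dimension at least two, with norm $|\cdot|$, and a proper domain $G\subsetneq E$ is a nonempty connected open set different from $E$; put $d_G(x)=\operatorname{dist}(x,\partial G)$ for $x\in G$. A curve is a continuous map of a compact interval, an arc is an injective curve, $\ell$ denotes length, and $\gamma[a,b]$ denotes the part of an arc $\gamma$ between two of its points $a,b$. For $c\ge 1$ and $0<\delta<1$ we say that: - $G$ is *$c$-uniform* if any two distinct points $x,y\in G$ can be joined by an arc $\gamma$ in $G$ such that $\ell(\gamma)\le c|x-y|$ and $\min\{\ell(\gamma[x,z]),\ell(\gamma[z,y])\}\le c\,d_G(z)$ for all $z\in\gamma$; - $G$ has the *min-max property with constant $c$* if there is a family $\Gamma$ of curves in $G$ such that any two points of $G$ can be joined by a curve $\gamma\in\Gamma$ satisfying $$\tfrac1c\min_{j=1,2}|x_j-y|\le|x-y|\le c\max_{j=1,2}|x_j-y|$$ for each ordered triple of points $x_1,x,x_2$ along $\gamma$ and each $y\in\partial G$; - $G$ is *diameter $c$-uniform* if any two distinct points $x_1,x_2\in G$ can be joined by an arc $\alpha$ in $G$ such that $\min_{j=1,2}\operatorname{diam}(\alpha[x_j,x])\le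 c\,d_G(x)$ for all $x\in\alpha$ and $\operatorname{diam}\alpha\le c|x_1-x_2|$; - $G$ is *$\delta$-uniform* if any two distinct points $x_1,x_2\in G$ can be joined by an arc $\alpha$ in $G$ such that $$\frac{|x-y|}{|x-x_i|}\cdot\frac{|x_i-x_j|}{|x_j-y|}\ge\delta,\qquad i\ne j\in\{1,2\},$$ for all $x\in\alpha\setminus\{x_1,x_2\}$ and all $y\in E\setminus G$. **Theorem.** For a proper domain $G$ in a real Banach space $E$ of dimension at least two, $$G\text{ is }c\text{-uniform}\ \Rightarrow\ G\text{ has the min-max property}\ \Rightarrow\ G\text{ is diameter }c_1\text{-uniform}\ \Leftrightarrow\ G\text{ is }\delta\text{-uniform for some }0<\delta<1.$$ In each implication the constant of the conclusion depends only on the constant of the hypothesis, and not on $E$ or $G$. That is: 1. for every $c\ge1$ there is $c'\ge1$ such that, for all such $E$ and $G$, if $G$ is $c$-uniform then $G$ has the min-max property with constant $c'$; 2. for every $c'\ge1$ there is $c_1\ge1$ such that, for all such $E$ and $G$, if $G$ has the min-max property with constant $c'$ then $G$ is diameter $c_1$-uniform; 3. for every $c_1\ge1$ there is $\delta\in(0,1)$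 such that, for all such $E$ and $G$, if $G$ is diameter $c_1$-uniform then $G$ is $\delta$-uniform; 4. for every $\delta\in(0,1)$ there is $c_1\ge1$ such that, for all such $E$ and $G$, if $G$ is $\delta$-uniform then $G$ is diameter $c_1$-uniform. -/

import Mathlib

open scoped unitInterval

universe u

/-- A proper domain of `E`: a nonempty connected open set different from the whole space. -/
structure IsProperDomain {E : Type u} [NormedAddCommGroup E] (G : Set E) : Prop where
  isOpen : IsOpen G
  isConnected : IsConnected G
  ne_univ : G ≠ Set.univ

/-- `d_G(x)`, the distance from `x` to the boundary of `G`. -/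
noncomputable def boundaryDist {E : Type u} [NormedAddCommGroup E] (G : Set E) (x : E) : ℝ :=
  Metric.infDist x (frontier G)

/-- `γ` is an arc in `G` (with end points `x` and `y`): an injective path with values in `G`.
For `z = γ t` the subarcs `γ[x,z]` and `γ[z,y]` are the restrictions of `γ` to `Set.Icc 0 t`
and `Set.Icc t 1`. -/
def IsArcIn {E : Type u} [NormedAddCommGroup E] {x y : E} (γ : Path x y) (G : Set E) : Prop :=
  Function.Injective γ ∧ ∀ t, γ t ∈ G

/-- The length of the restriction of a path to a set of parameters. -/
noncomputable def pathLength {E : Type u} [NormedAddCommGroup E] {x y : E} (γ : Path x y)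
    (s : Set I) : ENNReal :=
  eVariationOn (γ : I → E) s

/-- `c`-uniform sets. An arc has two distinct end points, so only pairs of distinct points are
considered. -/
def IsUniformDomain {E : Type u} [NormedAddCommGroup E] (c : ℝ) (G : Set E) : Prop :=
  ∀ x ∈ G, ∀ y ∈ G, x ≠ y → ∃ γ : Path x y, IsArcIn γ G ∧
    pathLength γ Set.univ ≤ ENNReal.ofReal (c * dist x y) ∧
    ∀ t : I, min (pathLength γ (Set.Icc 0 t)) (pathLength γ (Set.Icc t 1)) ≤
      ENNReal.ofReal (c * boundaryDist G (γ t))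

/-- Diameter `c`-uniform sets. -/
def IsDiameterUniform {E : Type u} [NormedAddCommGroup E] (c : ℝ) (G : Set E) : Prop :=
  ∀ x ∈ G, ∀ y ∈ G, x ≠ y → ∃ γ : Path x y, IsArcIn γ G ∧
    (∀ t : I, min (Metric.diam (γ '' Set.Icc 0 t)) (Metric.diam (γ '' Set.Icc t 1)) ≤
      c * boundaryDist G (γ t)) ∧
    Metric.diam (Set.range γ) ≤ c * dist x y

/-- The min-max property with constant `c`: there is a family `Γ` of (not necessarily injective)
curves in `G` such that any two points of `G` are joined by a member of `Γ` along which the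
min-max inequalities hold. -/
def HasMinMaxProperty {E : Type u} [NormedAddCommGroup E] (c : ℝ) (G : Set E) : Prop :=
  ∃ Γ : Set C(I, E), (∀ γ ∈ Γ, ∀ t, γ t ∈ G) ∧
    ∀ u ∈ G, ∀ v ∈ G, ∃ γ ∈ Γ, γ 0 = u ∧ γ 1 = v ∧
      ∀ t₁ t t₂ : I, t₁ ≤ t → t ≤ t₂ → ∀ y ∈ frontier G,
        (1 / c) * min (dist (γ t₁) y) (dist (γ t₂) y) ≤ dist (γ t) y ∧
        dist (γ t) y ≤ c * max (dist (γ t₁) y) (dist (γ t₂) y)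

/-- The cross ratio `τ(x,y,z,w) = (|x-z| / |x-y|) * (|y-w| / |z-w|)`. -/
noncomputable def crossRatio {E : Type u} [NormedAddCommGroup E] (x y z w : E) : ℝ :=
  dist x z / dist x y * (dist y w / dist z w)

/-- `δ`-uniform sets, in terms of cross ratios along arcs. -/
def IsCrossRatioUniform {E : Type u} [NormedAddCommGroup E] (δ : ℝ) (G : Set E) : Prop :=
  ∀ x₁ ∈ G, ∀ x₂ ∈ G, x₁ ≠ x₂ → ∃ α : Path x₁ x₂, IsArcIn α G ∧
    ∀ x ∈ Set.range α \ {x₁, x₂}, ∀ y ∈ Gᶜ,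
      δ ≤ crossRatio x x₁ y x₂ ∧ δ ≤ crossRatio x x₂ y x₁

section Basic

variable {E : Type u} [NormedAddCommGroup E] {G : Set E}

lemma boundaryDist_le_add (G : Set E) (x y : E) :
    boundaryDist G x ≤ boundaryDist G y + dist x y :=
  Metric.infDist_le_infDist_add_dist

lemma boundaryDist_le_dist {x y : E} (hy : y ∈ frontier G) : boundaryDist G x ≤ dist x y :=
  Metric.infDist_le_dist_of_mem hy

lemma continuous_boundaryDist (G : Set E) : Continuous (boundaryDist G) :=
  Metric.continuous_infDist_pt _

lemma IsProperDomain.frontier_nonempty [NormedSpace ℝ E] (hG : IsProperDomain G) :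
    (frontier G).Nonempty :=
  nonempty_frontier_iff.2 ⟨hG.isConnected.nonempty, hG.ne_univ⟩

lemma IsProperDomain.boundaryDist_pos [NormedSpace ℝ E] (hG : IsProperDomain G) {x : E}
    (hx : x ∈ G) : 0 < boundaryDist G x :=
  (isClosed_frontier.notMem_iff_infDist_pos hG.frontier_nonempty).1
    (fun h => (hG.isOpen.frontier_eq ▸ h).2 hx)

lemma IsProperDomain.boundaryDist_le_dist_of_notMem [NormedSpace ℝ E] (hG : IsProperDomain G)
    {x y : E} (hx : x ∈ G) (hy : y ∉ G) : boundaryDist G x ≤ dist x y := by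
  obtain ⟨z, hz, hzG⟩ : ∃ z ∈ segment ℝ x y, z ∈ frontier G := by
    by_contra! h
    have key : ∀ z ∈ segment ℝ x y, z ∉ G → z ∈ (closure G)ᶜ := fun z hz hzG hc =>
      h z hz (hG.isOpen.frontier_eq ▸ ⟨hc, hzG⟩)
    obtain ⟨z, -, hz1, hz2⟩ := (convex_segment x y).isPreconnected G (closure G)ᶜ hG.isOpen
      isClosed_closure.isOpen_compl
      (fun z hz => (em (z ∈ G)).imp id (key z hz))
      ⟨x, left_mem_segment ℝ x y, hx⟩
      ⟨y, right_mem_segment ℝ x y, key y (right_mem_segment ℝ x y) hy⟩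
    exact hz2 (subset_closure hz1)
  refine (boundaryDist_le_dist hzG).trans ?_
  rw [dist_comm]
  exact segment_subset_closedBall_left x y hz

lemma IsProperDomain.mem_of_dist_lt [NormedSpace ℝ E] (hG : IsProperDomain G) {x y : E}
    (hx : x ∈ G) (h : dist x y < boundaryDist G x) : y ∈ G := by
  by_contra hy
  exact (hG.boundaryDist_le_dist_of_notMem hx hy).not_gt h

end Basic

section Tracing

variable {E : Type u} [NormedAddCommGroup E] [NormedSpace ℝ E]

/-- The arc `α`, parametrized by `[0, a]`, runs from `g 0` to `g T` within distance `ε` of the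
restriction of the curve `g` to `[0, T]`, respecting the order of points. -/
structure TracesUpTo (ε : ℝ) (g : ℝ → E) (T a : ℝ) (α : ℝ → E) : Prop where
  continuousOn : ContinuousOn α (Set.Icc 0 a)
  injOn : Set.InjOn α (Set.Icc 0 a)
  source : α 0 = g 0
  target : α a = g T
  near : ∀ s ∈ Set.Icc 0 a, ∃ t ∈ Set.Icc 0 T, dist (α s) (g t) < ε ∧
    (∀ s' ∈ Set.Icc 0 s, ∃ t' ∈ Set.Icc 0 t, dist (α s') (g t') < ε) ∧
    ∀ s' ∈ Set.Icc s a, ∃ t' ∈ Set.Icc t T, dist (α s') (g t') < ε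

/-- A tracing arc is extended by a segment, which is joined to the arc at the first point where
the arc meets it. -/
lemma TracesUpTo.extend {ε : ℝ} {g : ℝ → E} {T T' a : ℝ} {α : ℝ → E} (ha : 0 ≤ a) (hT : 0 ≤ T)
    (hTT' : T ≤ T') (h : TracesUpTo ε g T a α) (hg : dist (g T') (g T) < ε) :
    ∃ a' α', 0 ≤ a' ∧ TracesUpTo ε g T' a' α' := by
  set q := g T'
  have hseg : ∀ z ∈ segment ℝ (g T) q, dist z (g T) < ε := fun z hz =>
    (convex_ball (g T) ε).segment_subset
      (Metric.mem_ball_self (dist_nonneg.trans_lt hg)) hg hz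
  have hclosed : IsClosed (segment ℝ (g T) q) := by
    rw [segment_eq_image_lineMap]
    exact (isCompact_Icc.image (by fun_prop)).isClosed
  obtain ⟨b, ⟨⟨hb0, hba⟩, hbS⟩, hbmin⟩ :
      ∃ b, IsLeast (Set.Icc 0 a ∩ α ⁻¹' segment ℝ (g T) q) b := by
    refine IsCompact.exists_isLeast ?_ ⟨a, ⟨ha, le_rfl⟩, ?_⟩
    · exact isCompact_Icc.of_isClosed_subset
        (h.continuousOn.preimage_isClosed_of_isClosed isClosed_Icc hclosed) Set.inter_subset_left
    · rw [Set.mem_preimage, h.target]; exact left_mem_segment ℝ _ _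
  set p := α b
  obtain ⟨l, hl0, hl1, hlq, hlp⟩ : ∃ l : ℝ, 0 ≤ l ∧ l ≤ 1 ∧ p + l • (q - p) = q ∧
      (0 < l → q - p ≠ 0) := by
    by_cases hpq : q = p
    · exact ⟨0, le_rfl, zero_le_one, by simp [hpq], fun h => (lt_irrefl _ h).elim⟩
    · exact ⟨1, zero_le_one, le_rfl, by simp, fun _ => sub_ne_zero.2 hpq⟩
  let α' : ℝ → E := fun s => if s ≤ b then α s else p + (s - b) • (q - p)
  have h1 : ∀ s, s ≤ b → α' s = α s := fun s hs => if_pos hs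
  have h2 : ∀ s, b ≤ s → α' s = p + (s - b) • (q - p) := fun s hs => by
    rcases hs.eq_or_lt with rfl | hs
    · rw [sub_self, zero_smul, add_zero]; exact if_pos le_rfl
    · exact if_neg hs.not_ge
  have hS : ∀ s ∈ Set.Icc b (b + l), α' s ∈ segment ℝ (g T) q := fun s hs => by
    rw [h2 s hs.1]
    refine (convex_segment (g T) q).segment_subset hbS (right_mem_segment ℝ _ _) ?_
    rw [segment_eq_image']
    exact ⟨s - b, ⟨by linarith [hs.1], by linarith [hs.2]⟩, rfl⟩
  have hnear : ∀ s ∈ Set.Icc b (b + l), dist (α' s) (g T) < ε := fun s hs => hseg _ (hS s hs)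
  have hinj : ∀ s ∈ Set.Icc 0 (b + l), ∀ s' ∈ Set.Icc 0 (b + l), s < s' → α' s ≠ α' s' := by
    intro s hs s' hs' hss' heq
    rcases le_or_gt s' b with hs'b | hs'b
    · rw [h1 s (hss'.le.trans hs'b), h1 s' hs'b] at heq
      exact hss'.ne (h.injOn ⟨hs.1, by linarith⟩ ⟨hs'.1, by linarith⟩ heq)
    · have hl : q - p ≠ 0 := hlp (by linarith [hs'.2])
      rcases le_or_gt b s with hsb | hsb
      · rw [h2 s hsb, h2 s' hs'b.le] at heq
        have : s - b = s' - b := smul_left_injective ℝ hl (add_left_cancel heq)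
        linarith
      · have := hS s' ⟨hs'b.le, hs'.2⟩
        rw [← heq, h1 s hsb.le] at this
        exact hsb.not_ge (hbmin ⟨⟨hs.1, by linarith⟩, this⟩)
  refine ⟨b + l, α', by positivity, ⟨?_, ?_, ?_, ?_, ?_⟩⟩
  · rw [← Set.Icc_union_Icc_eq_Icc hb0 (by linarith : b ≤ b + l)]
    refine ContinuousOn.union_of_isClosed ?_ ?_ isClosed_Icc isClosed_Icc
    · exact (h.continuousOn.mono (Set.Icc_subset_Icc_right hba)).congr fun s hs => h1 s hs.2
    · refine ContinuousOn.congr (f := fun s => p + (s - b) • (q - p)) ?_ fun s hs => h2 s hs.1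
      fun_prop
  · intro s hs s' hs' heq
    by_contra hne
    rcases lt_or_gt_of_ne hne with hlt | hlt
    · exact hinj s hs s' hs' hlt heq
    · exact hinj s' hs' s hs hlt heq.symm
  · rw [h1 0 hb0, h.source]
  · rw [h2 _ (by linarith), add_sub_cancel_left, hlq]
  · intro s hs
    rcases le_or_gt s b with hsb | hsb
    · obtain ⟨t, ht, htd, htl, htr⟩ := h.near s ⟨hs.1, hsb.trans hba⟩
      refine ⟨t, ⟨ht.1, ht.2.trans hTT'⟩, by rwa [h1 s hsb], fun s' hs' => ?_, fun s' hs' => ?_⟩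
      · rw [h1 s' (hs'.2.trans hsb)]; exact htl s' hs'
      · rcases le_or_gt s' b with hsb' | hsb'
        · obtain ⟨t', ht', h'⟩ := htr s' ⟨hs'.1, hsb'.trans hba⟩
          exact ⟨t', ⟨ht'.1, ht'.2.trans hTT'⟩, by rwa [h1 s' hsb']⟩
        · exact ⟨T, ⟨ht.2, hTT'⟩, hnear s' ⟨hsb'.le, hs'.2⟩⟩
    · refine ⟨T, ⟨hT, hTT'⟩, hnear s ⟨hsb.le, hs.2⟩, fun s' hs' => ?_, fun s' hs' =>
        ⟨T, ⟨le_rfl, hTT'⟩, hnear s' ⟨hsb.le.trans hs'.1, hs'.2⟩⟩⟩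
      rcases le_or_gt s' b with hsb' | hsb'
      · obtain ⟨t, ht, htd, -⟩ := h.near s' ⟨hs'.1, hsb'.trans hba⟩
        exact ⟨t, ht, by rwa [h1 s' hsb']⟩
      · exact ⟨T, ⟨hT, le_rfl⟩, hnear s' ⟨hsb'.le, hs'.2.trans hs.2⟩⟩

/-- Every curve with distinct end points can be replaced by an arc which stays close to it and
respects the order of points. -/
lemma Path.exists_injective_near {x y : E} (γ : Path x y) (hxy : x ≠ y) {ε : ℝ} (hε : 0 < ε) :
    ∃ α : Path x y, Function.Injective α ∧ ∀ s, ∃ t, dist (α s) (γ t) < ε ∧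
      (∀ s' ≤ s, ∃ t' ≤ t, dist (α s') (γ t') < ε) ∧
      ∀ s', s ≤ s' → ∃ t', t ≤ t' ∧ dist (α s') (γ t') < ε := by
  obtain ⟨δ, hδ, hγ⟩ := Metric.uniformContinuousOn_iff.1
    (isCompact_Icc.uniformContinuousOn_of_continuous
      γ.continuous_extend.continuousOn (s := Set.Icc (0 : ℝ) 1)) ε hε
  obtain ⟨n, hn⟩ := exists_nat_one_div_lt hδ
  have hn0 : (0 : ℝ) < n + 1 := by positivity
  have key : ∀ k : ℕ, k ≤ n + 1 → ∃ a α, 0 ≤ a ∧ TracesUpTo ε γ.extend (k / (n + 1)) a α := by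
    intro k
    induction k with
    | zero =>
      refine fun _ => ⟨0, fun _ => x, le_rfl, ⟨continuousOn_const, ?_, by simp, by simp, ?_⟩⟩
      · simp
      · intro s hs
        refine ⟨0, by simp, by simpa using hε, fun s' hs' => ⟨0, by simp, by simpa using hε⟩,
          fun s' hs' => ⟨0, by simp, by simpa using hε⟩⟩
    | succ k ih =>
      intro hk
      obtain ⟨a, α, ha, h⟩ := ih (by omega)
      have hk' : (k : ℝ) + 1 ≤ n + 1 := by exact_mod_cast hk
      have hle : (k : ℝ) / (n + 1) ≤ ((k + 1 : ℕ) : ℝ) / (n + 1) := by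
        push_cast; gcongr; linarith
      have hle1 : ((k + 1 : ℕ) : ℝ) / (n + 1) ≤ 1 := by
        push_cast; exact (div_le_one hn0).2 hk'
      refine h.extend ha (by positivity) hle (hγ _ ⟨by positivity, hle1⟩ _
        ⟨by positivity, hle.trans hle1⟩ ?_)
      rw [Real.dist_eq, ← sub_div]
      push_cast
      rw [add_sub_cancel_left, abs_of_pos (by positivity)]
      exact hn
  obtain ⟨a, α, ha, h⟩ := key (n + 1) le_rfl
  have h1 : (((n + 1 : ℕ) : ℝ) / (n + 1)) = 1 := by push_cast; exact div_self hn0.ne'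
  rw [h1] at h
  have hx : α 0 = x := by rw [h.source, γ.extend_zero]
  have hy : α a = y := by rw [h.target, γ.extend_one]
  have ha0 : 0 < a := ha.lt_of_ne (by rintro rfl; exact hxy (hx.symm.trans hy))
  have hmem : ∀ s : I, a * s ∈ Set.Icc 0 a := fun s =>
    ⟨mul_nonneg ha s.2.1, mul_le_of_le_one_right ha s.2.2⟩
  refine ⟨⟨⟨fun s => α (a * s), ?_⟩, by simpa using hx, by simpa using hy⟩, ?_, ?_⟩
  · exact h.continuousOn.comp_continuous (by fun_prop) hmem
  · intro s s' hss'
    exact Subtype.ext (mul_left_cancel₀ ha0.ne' (h.injOn (hmem s) (hmem s') hss'))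
  · intro s
    obtain ⟨t, ht, htd, htl, htr⟩ := h.near _ (hmem s)
    refine ⟨⟨t, ht⟩, ?_, fun s' hs' => ?_, fun s' hs' => ?_⟩
    · rw [γ.extend_apply ht] at htd; exact htd
    · obtain ⟨t', ht', h'⟩ := htl (a * s') ⟨(hmem s').1, mul_le_mul_of_nonneg_left hs' ha⟩
      rw [γ.extend_apply ⟨ht'.1, ht'.2.trans ht.2⟩] at h'
      exact ⟨_, ht'.2, h'⟩
    · obtain ⟨t', ht', h'⟩ := htr (a * s') ⟨mul_le_mul_of_nonneg_left hs' ha, (hmem s').2⟩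
      rw [γ.extend_apply ⟨ht.1.trans ht'.1, ht'.2⟩] at h'
      exact ⟨_, ht'.1, h'⟩

end Tracing

section Uniformity

variable {E : Type u} [NormedAddCommGroup E] {G : Set E}

lemma Path.isBounded_image {x y : E} (γ : Path x y) (s : Set I) :
    Bornology.IsBounded (γ '' s) :=
  (isCompact_range γ.continuous).isBounded.subset (Set.image_subset_range _ _)

lemma IsUniformDomain.isDiameterUniform {c : ℝ} (hc : 0 ≤ c) (h : IsUniformDomain c G) :
    IsDiameterUniform c G := by
  have diam_le : ∀ {x y : E} (γ : Path x y) (s : Set I) (r : ℝ), 0 ≤ r →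
      pathLength γ s ≤ ENNReal.ofReal r → Metric.diam (γ '' s) ≤ r := by
    intro x y γ s r hr hs
    refine Metric.diam_le_of_forall_dist_le hr ?_
    rintro _ ⟨t, ht, rfl⟩ _ ⟨t', ht', rfl⟩
    rw [← edist_le_ofReal hr]
    exact (eVariationOn.edist_le _ ht ht').trans hs
  intro x hx y hy hxy
  obtain ⟨γ, hγ, hlen, hcig⟩ := h x hx y hy hxy
  refine ⟨γ, hγ, fun t => ?_, ?_⟩
  · have hr : 0 ≤ c * boundaryDist G (γ t) := mul_nonneg hc Metric.infDist_nonneg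
    rcases min_le_iff.1 (hcig t) with h | h
    · exact (min_le_left _ _).trans (diam_le γ _ _ hr h)
    · exact (min_le_right _ _).trans (diam_le γ _ _ hr h)
  · rw [← Set.image_univ]
    exact diam_le γ _ _ (by positivity) hlen

lemma IsDiameterUniform.exists_path {c : ℝ} (h : IsDiameterUniform c G) {x y : E} (hx : x ∈ G)
    (hy : y ∈ G) (hxy : x ≠ y) : ∃ γ : Path x y, IsArcIn γ G ∧
      (∀ t, (∀ s ≤ t, dist (γ s) (γ t) ≤ c * boundaryDist G (γ t)) ∨
        ∀ s, t ≤ s → dist (γ s) (γ t) ≤ c * boundaryDist G (γ t)) ∧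
      ∀ s t, dist (γ s) (γ t) ≤ c * dist x y := by
  obtain ⟨γ, hγ, hcig, hdiam⟩ := h x hx y hy hxy
  refine ⟨γ, hγ, fun t => ?_, fun s t => ?_⟩
  · refine (min_le_iff.1 (hcig t)).imp (fun h s hs => ?_) fun h s hs => ?_
    · exact (Metric.dist_le_diam_of_mem (γ.isBounded_image (Set.Icc 0 t))
        ⟨s, ⟨s.2.1, hs⟩, rfl⟩ ⟨t, ⟨t.2.1, le_rfl⟩, rfl⟩).trans h
    · exact (Metric.dist_le_diam_of_mem (γ.isBounded_image (Set.Icc t 1))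
        ⟨s, ⟨hs, s.2.2⟩, rfl⟩ ⟨t, ⟨le_rfl, t.2.2⟩, rfl⟩).trans h
  · exact (Metric.dist_le_diam_of_mem (isCompact_range γ.continuous).isBounded
      (Set.mem_range_self s) (Set.mem_range_self t)).trans hdiam

lemma IsDiameterUniform.hasMinMaxProperty {c : ℝ} (hc : 1 ≤ c) (h : IsDiameterUniform c G) :
    HasMinMaxProperty (1 + 2 * c * (1 + c)) G := by
  set K := 1 + 2 * c * (1 + c)
  have hcK : 1 + c ≤ K := by simp only [K]; nlinarith
  have hK0 : 0 < K := by linarith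
  refine ⟨{γ | ∀ t, γ t ∈ G}, fun γ hγ => hγ, fun u hu v hv => ?_⟩
  by_cases huv : u = v
  · subst huv
    refine ⟨ContinuousMap.const I u, fun _ => hu, rfl, rfl, fun t₁ t t₂ _ _ y _ => ?_⟩
    have := dist_nonneg (x := u) (y := y)
    simp only [ContinuousMap.const_apply, min_self, max_self]
    rw [one_div, inv_mul_le_iff₀ hK0]
    constructor <;> nlinarith
  obtain ⟨γ, hγ, hcig, hdiam⟩ := h.exists_path hu hv huv
  refine ⟨γ.toContinuousMap, hγ.2, γ.source, γ.target, fun t₁ t t₂ h₁ h₂ y hy => ?_⟩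
  change (1 / K) * min (dist (γ t₁) y) (dist (γ t₂) y) ≤ dist (γ t) y ∧
    dist (γ t) y ≤ K * max (dist (γ t₁) y) (dist (γ t₂) y)
  have hb : ∀ s, c * boundaryDist G (γ s) ≤ c * dist (γ s) y := fun s =>
    mul_le_mul_of_nonneg_left (boundaryDist_le_dist hy) (by linarith)
  have hn : ∀ s, 0 ≤ dist (γ s) y := fun s => dist_nonneg
  constructor
  · rw [one_div, inv_mul_le_iff₀ hK0]
    refine le_trans ?_ (mul_le_mul_of_nonneg_right hcK (hn t))
    rcases hcig t with h | h
    · exact (min_le_left _ _).trans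
        (by linarith [dist_triangle (γ t₁) (γ t) y, h t₁ h₁, hb t])
    · exact (min_le_right _ _).trans
        (by linarith [dist_triangle (γ t₂) (γ t) y, h t₂ h₂, hb t])
  · have hl := le_max_left (dist (γ t₁) y) (dist (γ t₂) y)
    have hr := le_max_right (dist (γ t₁) y) (dist (γ t₂) y)
    set M := max (dist (γ t₁) y) (dist (γ t₂) y)
    have hM : 0 ≤ M := (hn t₁).trans hl
    rcases hcig t₁ with a₁ | a₁
    swap
    · have := mul_le_mul_of_nonneg_left hl (by linarith : 0 ≤ 1 + c)
      have := mul_le_mul_of_nonneg_right hcK hM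
      linarith [dist_triangle (γ t) (γ t₁) y, a₁ t h₁, hb t₁]
    rcases hcig t₂ with a₂ | a₂
    · have := mul_le_mul_of_nonneg_left hr (by linarith : 0 ≤ 1 + c)
      have := mul_le_mul_of_nonneg_right hcK hM
      linarith [dist_triangle (γ t) (γ t₂) y, a₂ t h₂, hb t₂]
    · have e₁ := a₁ 0 t₁.2.1
      have e₂ := a₂ 1 t₂.2.2
      rw [γ.source] at e₁
      rw [γ.target] at e₂
      have huv : dist u v ≤ 2 * (1 + c) * M := by
        have := mul_le_mul_of_nonneg_left hl (by linarith : 0 ≤ 1 + c)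
        have := mul_le_mul_of_nonneg_left hr (by linarith : 0 ≤ 1 + c)
        linarith [dist_triangle4 u (γ t₁) (γ t₂) v, dist_triangle_right (γ t₁) (γ t₂) y,
          dist_comm v (γ t₂), hb t₁, hb t₂]
      have := mul_le_mul_of_nonneg_left huv (by linarith : 0 ≤ c)
      have e : K * M = M + c * (2 * (1 + c) * M) := by simp only [K]; ring
      linarith [dist_triangle (γ t) (γ t₁) y, hdiam t t₁]

lemma IsDiameterUniform.isCrossRatioUniform [NormedSpace ℝ E] (hG : IsProperDomain G) {c : ℝ}
    (hc : 1 ≤ c) (h : IsDiameterUniform c G) : IsCrossRatioUniform (1 / (c * (2 + c))) G := by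
  have key : ∀ {x y p q : E}, x ∈ G → y ∉ G → p ∈ G → q ∈ G → p ≠ q → x ≠ p →
      dist p x ≤ c * dist p q →
      (dist p x ≤ c * boundaryDist G x ∨ dist q x ≤ c * boundaryDist G x) →
      1 / (c * (2 + c)) ≤ crossRatio x p y q := by
    intro x y p q hx hy hp hq hpq hxp hd hcig
    have hb := mul_le_mul_of_nonneg_left (hG.boundaryDist_le_dist_of_notMem hx hy)
      (by linarith : 0 ≤ c)
    have hyq : y ≠ q := by rintro rfl; exact hy hq
    have h1 := dist_pos.2 hxp
    have h2 := dist_pos.2 hyq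
    rw [crossRatio, div_mul_div_comm, div_le_div_iff₀ (by positivity) (by positivity), one_mul]
    rw [dist_comm p x] at *
    have hxy : 0 ≤ dist x y := dist_nonneg
    have hpq0 := dist_pos.2 hpq
    rcases hcig with h | h
    · have hyq' : dist y q ≤ dist p q + (1 + c) * dist x y := by
        linarith [dist_triangle4 y x p q, dist_comm y x]
      have i1 := mul_le_mul_of_nonneg_left hyq' h1.le
      have i2 := mul_le_mul_of_nonneg_right (h.trans hb) hpq0.le
      have i3 := mul_le_mul_of_nonneg_right hd (by positivity : 0 ≤ (1 + c) * dist x y)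
      linarith
    · have hyq' : dist y q ≤ (1 + c) * dist x y := by
        linarith [dist_triangle y x q, dist_comm y x, dist_comm q x]
      have i1 := mul_le_mul hd hyq' h2.le (by positivity)
      have i2 : 0 ≤ c * (dist x y * dist p q) := by positivity
      linarith
  intro p hp q hq hpq
  obtain ⟨γ, hγ, hcig, hdiam⟩ := h.exists_path hp hq hpq
  refine ⟨γ, hγ, ?_⟩
  rintro _ ⟨⟨t, rfl⟩, ht⟩ y hy
  simp only [Set.mem_insert_iff, Set.mem_singleton_iff, not_or] at ht
  have e : dist p (γ t) ≤ c * boundaryDist G (γ t) ∨ dist q (γ t) ≤ c * boundaryDist G (γ t) :=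
    (hcig t).imp (fun h => by simpa using h 0 t.2.1) fun h => by simpa using h 1 t.2.2
  have d₁ := hdiam 0 t
  have d₂ := hdiam 1 t
  rw [γ.source] at d₁
  rw [γ.target] at d₂
  exact ⟨key (hγ.2 t) hy hp hq hpq ht.1 d₁ e,
    key (hγ.2 t) hy hq hp hpq.symm ht.2 (by rwa [dist_comm q p]) e.symm⟩

/-- A curve along which every point is far from the boundary in comparison with the initial part
or with the final part of the curve can be replaced by an arc with this property. -/
lemma IsProperDomain.exists_diameter_arc [NormedSpace ℝ E] (hG : IsProperDomain G) {K : ℝ}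
    (hK : 0 ≤ K) {x y : E} (hxy : x ≠ y) (γ : Path x y) (hγ : ∀ t, γ t ∈ G)
    (hcig : ∀ t, (∀ s ≤ t, dist (γ s) x ≤ K * boundaryDist G (γ t)) ∨
      ∀ s, t ≤ s → dist (γ s) y ≤ K * boundaryDist G (γ t))
    (hdiam : ∀ t, dist (γ t) x ≤ K * dist x y) :
    ∃ α : Path x y, IsArcIn α G ∧
      (∀ t : I, min (Metric.diam (α '' Set.Icc 0 t)) (Metric.diam (α '' Set.Icc t 1)) ≤
        (4 * K + 2) * boundaryDist G (α t)) ∧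
      Metric.diam (Set.range α) ≤ (4 * K + 2) * dist x y := by
  obtain ⟨t₀, ht₀⟩ : ∃ t₀, ∀ t, boundaryDist G (γ t₀) ≤ boundaryDist G (γ t) := by
    obtain ⟨t₀, -, h⟩ := isCompact_univ.exists_isMinOn (Set.univ_nonempty (α := I))
      ((continuous_boundaryDist G).comp γ.continuous).continuousOn
    exact ⟨t₀, fun t => h (Set.mem_univ t)⟩
  set m := boundaryDist G (γ t₀)
  have hm : 0 < m := hG.boundaryDist_pos (hγ t₀)
  have hr : 0 < dist x y := dist_pos.2 hxy
  obtain ⟨ε, hε, hεm, hεr⟩ : ∃ ε > 0, ε ≤ m / 2 ∧ ε ≤ dist x y :=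
    ⟨min (m / 2) (dist x y), by positivity, min_le_left _ _, min_le_right _ _⟩
  obtain ⟨α, hinj, hα⟩ := γ.exists_injective_near hxy hε
  have diam_le : ∀ (z : E) (s : Set I) (r : ℝ), 0 ≤ r → (∀ t ∈ s, dist (α t) z ≤ r) →
      Metric.diam (α '' s) ≤ 2 * r := fun z s r hr h =>
    Metric.diam_le_of_subset_closedBall hr (Set.image_subset_iff.2 fun t ht => h t ht)
  refine ⟨α, ⟨hinj, fun s => ?_⟩, fun s => ?_, ?_⟩
  · obtain ⟨t, ht, -⟩ := hα s
    refine hG.mem_of_dist_lt (hγ t) ?_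
    rw [dist_comm]
    linarith [ht₀ t]
  · obtain ⟨t, ht, htl, htr⟩ := hα s
    have hd : boundaryDist G (γ t) ≤ 2 * boundaryDist G (α s) := by
      linarith [ht₀ t, boundaryDist_le_add G (γ t) (α s), dist_comm (γ t) (α s)]
    have hd' : ε ≤ boundaryDist G (α s) := by linarith [ht₀ t]
    have hKd := mul_le_mul_of_nonneg_left hd hK
    have hd0 : 0 ≤ boundaryDist G (α s) := hε.le.trans hd'
    have e : (4 * K + 2) * boundaryDist G (α s) = 2 * ((2 * K + 1) * boundaryDist G (α s)) := by
      ring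
    rw [e]
    rcases hcig t with h | h
    · refine (min_le_left _ _).trans (diam_le x _ _ (by positivity) fun s' hs' => ?_)
      obtain ⟨t', ht', h'⟩ := htl s' hs'.2
      linarith [dist_triangle (α s') (γ t') x, h t' ht']
    · refine (min_le_right _ _).trans (diam_le y _ _ (by positivity) fun s' hs' => ?_)
      obtain ⟨t', ht', h'⟩ := htr s' hs'.1
      linarith [dist_triangle (α s') (γ t') y, h t' ht']
  · rw [← Set.image_univ]
    refine (diam_le x _ ((K + 1) * dist x y) (by positivity) fun s _ => ?_).trans ?_
    · obtain ⟨t, ht, -⟩ := hα s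
      linarith [dist_triangle (α s) (γ t) x, hdiam t]
    · have : 0 ≤ K * dist x y := by positivity
      linarith

end Uniformity

section PathTrans

variable {X : Type*} [TopologicalSpace X] {x y z : X}

lemma Path.trans_apply_of_le (γ : Path x y) (η : Path y z) {t : I} (ht : (t : ℝ) ≤ 1 / 2) :
    γ.trans η t = γ (Set.projIcc 0 1 zero_le_one (2 * t)) := by
  rw [Path.trans_apply, dif_pos ht, Set.projIcc_of_mem]

lemma Path.trans_apply_of_ge (γ : Path x y) (η : Path y z) {t : I} (ht : 1 / 2 < (t : ℝ)) :
    γ.trans η t = η (Set.projIcc 0 1 zero_le_one (2 * t - 1)) := by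
  rw [Path.trans_apply, dif_neg ht.not_ge, Set.projIcc_of_mem]

lemma Path.trans_forall_le {P : X → X → Prop} (γ : Path x y) (η : Path y z)
    (hγ : ∀ s t, s ≤ t → P (γ s) (γ t)) (hη : ∀ s t, s ≤ t → P (η s) (η t))
    (hγη : ∀ s t, P (γ s) (η t)) (s t : I) (hst : s ≤ t) :
    P (γ.trans η s) (γ.trans η t) := by
  have hst' : (s : ℝ) ≤ t := hst
  rcases le_or_gt (t : ℝ) (1 / 2) with ht | ht
  · rw [trans_apply_of_le γ η ht, trans_apply_of_le γ η (hst'.trans ht)]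
    exact hγ _ _ (Set.monotone_projIcc _ (by linarith))
  · rw [trans_apply_of_ge γ η ht]
    rcases le_or_gt (s : ℝ) (1 / 2) with hs | hs
    · rw [trans_apply_of_le γ η hs]
      exact hγη _ _
    · rw [trans_apply_of_ge γ η hs]
      exact hη _ _ (Set.monotone_projIcc _ (by linarith))

lemma Path.trans_symm_forall {P Q : X → X → Prop} (γ : Path x y) (η : Path z y)
    (hγ : ∀ s t, s ≤ t → P (γ s) (γ t)) (hη : ∀ s t, s ≤ t → Q (η s) (η t)) (t : I) :
    (∀ s ≤ t, P (γ.trans η.symm s) (γ.trans η.symm t)) ∨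
      ∀ s, t ≤ s → Q (γ.trans η.symm s) (γ.trans η.symm t) := by
  rcases le_or_gt (t : ℝ) (1 / 2) with ht | ht
  · refine Or.inl fun s hs => ?_
    have hs' : (s : ℝ) ≤ t := hs
    rw [trans_apply_of_le γ _ ht, trans_apply_of_le γ _ (hs'.trans ht)]
    exact hγ _ _ (Set.monotone_projIcc _ (by linarith))
  · refine Or.inr fun s hs => ?_
    have hs' : (t : ℝ) ≤ s := hs
    rw [trans_apply_of_ge γ _ ht, trans_apply_of_ge γ _ (ht.trans_le hs')]
    exact hη _ _ (unitInterval.symm_le_symm.2 (Set.monotone_projIcc _ (by linarith)))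

lemma Path.trans_forall {P : X → Prop} (γ : Path x y) (η : Path y z) (hγ : ∀ t, P (γ t))
    (hη : ∀ t, P (η t)) (t : I) : P (γ.trans η t) :=
  Path.trans_forall_le (P := fun _ a => P a) γ η (fun _ t _ => hγ t) (fun _ t _ => hη t)
    (fun _ t => hη t) t t le_rfl

end PathTrans

section DistanceCigars

variable {E : Type u} [NormedAddCommGroup E] {G : Set E}

/-- Any two points of `G` can be joined by a curve of comparable diameter along which the distance
to the nearer end point is at most `C` times the distance to the boundary. -/
def HasDistanceCigars (C : ℝ) (G : Set E) : Prop :=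
  ∀ x ∈ G, ∀ y ∈ G, ∃ γ : Path x y, ∀ t, γ t ∈ G ∧ dist (γ t) x ≤ C * dist x y ∧
    min (dist (γ t) x) (dist (γ t) y) ≤ C * boundaryDist G (γ t)

lemma HasDistanceCigars.exists_path_far {C : ℝ} (hC : 1 ≤ C) (h : HasDistanceCigars C G) {ρ : ℝ}
    {x y : E} (hx : x ∈ G) (hy : y ∈ G) (hρx : ρ ≤ boundaryDist G x)
    (hρy : ρ ≤ boundaryDist G y) :
    ∃ γ : Path x y, ∀ t, γ t ∈ G ∧ dist (γ t) x ≤ C * dist x y ∧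
      ρ ≤ 2 * C * boundaryDist G (γ t) := by
  obtain ⟨γ, hγ⟩ := h x hx y hy
  refine ⟨γ, fun t => ⟨(hγ t).1, (hγ t).2.1, ?_⟩⟩
  have h0 : boundaryDist G (γ t) ≤ C * boundaryDist G (γ t) :=
    le_mul_of_one_le_left Metric.infDist_nonneg hC
  rcases min_le_iff.1 (hγ t).2.2 with h | h
  · linarith [boundaryDist_le_add G x (γ t), dist_comm x (γ t)]
  · linarith [boundaryDist_le_add G y (γ t), dist_comm y (γ t)]

lemma HasDistanceCigars.exists_mem_sphere {C : ℝ} (h : HasDistanceCigars C G) {x y : E}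
    (hx : x ∈ G) (hy : y ∈ G) {ρ : ℝ} (hρ : 0 < ρ) (hρR : ρ ≤ dist x y / 2) :
    ∃ z ∈ G, dist z x = ρ ∧ ρ ≤ C * boundaryDist G z := by
  obtain ⟨γ, hγ⟩ := h x hx y hy
  obtain ⟨t, ht⟩ : ρ ∈ Set.range fun t => dist (γ t) x :=
    mem_range_of_exists_le_of_exists_ge (by fun_prop)
      ⟨0, by simpa using hρ.le⟩ ⟨1, by rw [γ.target, dist_comm]; linarith⟩
  refine ⟨γ t, (hγ t).1, ht, le_trans (le_min ht.ge ?_) (hγ t).2.2⟩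
  simp only at ht
  linarith [dist_triangle_left x y (γ t)]

end DistanceCigars

section Cigars

variable {E : Type u} [NormedAddCommGroup E] [NormedSpace ℝ E] {G : Set E}

lemma exists_path_dist_le (x y : E) : ∃ γ : Path x y, ∀ t, dist (γ t) x ≤ dist x y := by
  have h : JoinedIn (Metric.closedBall x (dist x y)) x y :=
    ((convex_closedBall x (dist x y)).isPathConnected
      ⟨x, Metric.mem_closedBall_self dist_nonneg⟩).joinedIn x
      (Metric.mem_closedBall_self dist_nonneg) y (by rw [Metric.mem_closedBall, dist_comm])
  exact ⟨h.somePath, fun t => h.somePath_mem t⟩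

lemma HasMinMaxProperty.isDiameterUniform (hG : IsProperDomain G) {c : ℝ} (hc : 1 ≤ c)
    (h : HasMinMaxProperty c G) : IsDiameterUniform (4 * (4 * c + 3) + 2) G := by
  obtain ⟨Γ, hΓ, hmm⟩ := h
  intro x hx y hy hxy
  have hr : 0 < dist x y := dist_pos.2 hxy
  suffices ∃ γ : Path x y, (∀ t, γ t ∈ G) ∧
      (∀ t, (∀ s ≤ t, dist (γ s) x ≤ (4 * c + 3) * boundaryDist G (γ t)) ∨
        ∀ s, t ≤ s → dist (γ s) y ≤ (4 * c + 3) * boundaryDist G (γ t)) ∧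
      ∀ t, dist (γ t) x ≤ (4 * c + 3) * dist x y by
    obtain ⟨γ, h1, h2, h3⟩ := this
    exact hG.exists_diameter_arc (by linarith) hxy γ h1 h2 h3
  rcases lt_or_ge (2 * dist x y) (boundaryDist G x) with hd | hd
  · obtain ⟨γ, hγ⟩ := exists_path_dist_le x y
    have hb : ∀ t, dist x y ≤ (4 * c + 3) * boundaryDist G (γ t) := fun t => by
      have : dist x y ≤ boundaryDist G (γ t) := by
        linarith [boundaryDist_le_add G x (γ t), hγ t, dist_comm x (γ t)]
      nlinarith
    refine ⟨γ, fun t => hG.mem_of_dist_lt hx ?_, fun t => Or.inl fun s _ => (hγ s).trans (hb t),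
      fun t => (hγ t).trans ?_⟩
    · linarith [hγ t, dist_comm x (γ t)]
    · nlinarith
  · obtain ⟨γ', hγ', h0, h1, hγ⟩ := hmm x hx y hy
    let γ : Path x y := ⟨γ', h0, h1⟩
    have hγG : ∀ t, γ t ∈ G := hΓ γ' hγ'
    replace hγ : ∀ t₁ t t₂ : I, t₁ ≤ t → t ≤ t₂ → ∀ w ∈ frontier G,
      min (dist (γ t₁) w) (dist (γ t₂) w) ≤ c * dist (γ t) w ∧
      dist (γ t) w ≤ c * max (dist (γ t₁) w) (dist (γ t₂) w) := by
      intro t₁ t t₂ h₁ h₂ w hw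
      obtain ⟨e₁, e₂⟩ := hγ t₁ t t₂ h₁ h₂ w hw
      rw [one_div, inv_mul_le_iff₀ (by linarith)] at e₁
      exact ⟨e₁, e₂⟩
    refine ⟨γ, hγG, fun t => ?_, fun t => ?_⟩
    · have hd0 := hG.boundaryDist_pos (hγG t)
      obtain ⟨w, hw, hwd⟩ := (Metric.infDist_lt_iff hG.frontier_nonempty).1
        (show Metric.infDist (γ t) (frontier G) < 2 * boundaryDist G (γ t) by
          change boundaryDist G (γ t) < _; linarith)
      have hwc : c * dist (γ t) w ≤ c * (2 * boundaryDist G (γ t)) :=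
        mul_le_mul_of_nonneg_left hwd.le (by linarith)
      by_cases H : ∀ s ≤ t, dist (γ s) w ≤ c * (2 * boundaryDist G (γ t))
      · refine Or.inl fun s hs => ?_
        have := H 0 t.2.1
        rw [γ.source] at this
        linarith [H s hs, dist_triangle_right (γ s) x w]
      · push Not at H
        obtain ⟨s₁, hs₁, hlt⟩ := H
        have H' : ∀ s, t ≤ s → dist (γ s) w ≤ c * (2 * boundaryDist G (γ t)) := fun s hs =>
          (min_le_iff.1 ((hγ s₁ t s hs₁ hs w hw).1.trans hwc)).resolve_left hlt.not_ge
        refine Or.inr fun s hs => ?_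
        have := H' 1 t.2.2
        rw [γ.target] at this
        linarith [H' s hs, dist_triangle_right (γ s) y w]
    · obtain ⟨w, hw, hwd⟩ := (Metric.infDist_lt_iff hG.frontier_nonempty).1
        (show Metric.infDist x (frontier G) < 3 * dist x y by
          change boundaryDist G x < _; linarith)
      have h2 := (hγ 0 t 1 t.2.1 t.2.2 w hw).2
      rw [γ.source, γ.target] at h2
      have hm : max (dist x w) (dist y w) ≤ 4 * dist x y :=
        max_le (by linarith) (by linarith [dist_triangle y x w, dist_comm x y])
      have := mul_le_mul_of_nonneg_left hm (by linarith : 0 ≤ c)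
      linarith [dist_triangle_right (γ t) x w]

lemma continuous_radialRetraction (x : E) {R : ℝ} (hR : 0 < R) :
    Continuous fun p : E => x + (R / max R (dist p x)) • (p - x) := by
  have : ∀ p : E, max R (dist p x) ≠ 0 := fun p => (lt_max_of_lt_left hR).ne'
  fun_prop (disch := exact this _)

lemma IsCrossRatioUniform.hasDistanceCigars (hG : IsProperDomain G) {δ : ℝ} (hδ : 0 < δ)
    (hδ1 : δ ≤ 1) (h : IsCrossRatioUniform δ G) : HasDistanceCigars (4 / δ + 2) G := by
  intro x hx y hy
  set M := 4 / δ + 2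
  have hMδ : δ * M = 4 + 2 * δ := by simp only [M]; field_simp
  have hM : 2 < M := by have : 0 < 4 / δ := by positivity
                        linarith
  by_cases hxy : x = y
  · subst hxy
    refine ⟨Path.refl x, fun t => ⟨hx, ?_, ?_⟩⟩
    · simp
    · simp only [Path.refl_apply, dist_self, min_self]
      exact mul_nonneg (by linarith) Metric.infDist_nonneg
  have hr : 0 < dist x y := dist_pos.2 hxy
  obtain ⟨α, ⟨-, hαG⟩, hα⟩ := h x hx y hy hxy
  have hα' : ∀ t, ∀ w ∉ G, δ * (dist (α t) x * dist w y) ≤ dist (α t) w * dist x y ∧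
      δ * (dist (α t) y * dist w x) ≤ dist (α t) w * dist x y := by
    intro t w hw
    have hwx : 0 < dist w x := dist_pos.2 (by rintro rfl; exact hw hx)
    have hwy : 0 < dist w y := dist_pos.2 (by rintro rfl; exact hw hy)
    by_cases hzx : α t = x
    · rw [hzx, dist_self, zero_mul, mul_zero, dist_comm x w, mul_comm (dist w x)]
      exact ⟨by positivity, mul_le_of_le_one_left (by positivity) hδ1⟩
    by_cases hzy : α t = y
    · rw [hzy, dist_self, zero_mul, mul_zero, dist_comm y w, dist_comm y x, mul_comm (dist w y)]
      exact ⟨mul_le_of_le_one_left (by positivity) hδ1, by positivity⟩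
    obtain ⟨e₁, e₂⟩ := hα (α t) ⟨⟨t, rfl⟩, by simp [hzx, hzy]⟩ w hw
    have h1 := dist_pos.2 hzx
    have h2 := dist_pos.2 hzy
    rw [crossRatio, div_mul_div_comm, le_div_iff₀ (by positivity)] at e₁ e₂
    exact ⟨e₁, by rwa [dist_comm y x] at e₂⟩
  have hcig : ∀ t, min (dist (α t) x) (dist (α t) y) ≤ M * boundaryDist G (α t) := by
    intro t
    rw [← div_le_iff₀' (by linarith)]
    refine (Metric.le_infDist hG.frontier_nonempty).2 fun {w} hw => ?_
    have hwG : w ∉ G := (hG.isOpen.frontier_eq ▸ hw : w ∈ closure G \ G).2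
    obtain ⟨e₁, e₂⟩ := hα' t w hwG
    rw [div_le_iff₀' (by linarith)]
    have hw0 : 0 ≤ dist (α t) w := dist_nonneg
    have key : ∀ {p q : ℝ}, 0 ≤ p → dist x y ≤ 2 * q →
        δ * (p * q) ≤ dist (α t) w * dist x y → p ≤ M * dist (α t) w := by
      intro p q hp hq hpq
      have i1 := mul_le_mul_of_nonneg_left hq (mul_nonneg hδ.le hp)
      have i2 : δ * p ≤ 2 * dist (α t) w := le_of_mul_le_mul_right (by linarith) hr
      have i3 : δ * (M * dist (α t) w) = (4 + 2 * δ) * dist (α t) w := by rw [← mul_assoc, hMδ]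
      have i4 : 0 ≤ δ * dist (α t) w := by positivity
      exact le_of_mul_le_mul_left (by linarith) hδ
    rcases le_total (dist w x) (dist w y) with hle | hle
    · exact (min_le_left _ _).trans
        (key dist_nonneg (by linarith [dist_triangle_left x y w]) e₁)
    · exact (min_le_right _ _).trans
        (key dist_nonneg (by linarith [dist_triangle_left x y w]) e₂)
  by_cases H : ∀ t, dist (α t) x ≤ M * dist x y
  · exact ⟨α, fun t => ⟨hαG t, H t, hcig t⟩⟩
  push Not at H
  obtain ⟨t₀, ht₀⟩ := H
  set R := M * dist x y
  have hrR : dist x y ≤ R := by simp only [R]; nlinarith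
  have hR : 0 < R := hr.trans_le hrR
  have hcompl : ∀ w ∉ G, dist w x ≤ (M - 1) * dist x y := by
    intro w hw
    obtain ⟨e₁, -⟩ := hα' t₀ w hw
    set D := dist (α t₀) x
    have hD : 0 < D := hR.trans ht₀
    have hDr : (4 + 2 * δ) * dist x y ≤ δ * D := by
      rw [← hMδ, mul_assoc]
      exact mul_le_mul_of_nonneg_left ht₀.le hδ.le
    have hw0 : 0 ≤ dist w y := dist_nonneg
    have i1 : dist (α t₀) w ≤ D + dist x y + dist w y := by
      linarith [dist_triangle4 (α t₀) x y w, dist_comm y w]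
    have i2 := mul_le_mul_of_nonneg_right i1 hr.le
    have i3 := mul_le_mul_of_nonneg_right hDr hw0
    have i4 : 0 ≤ δ * dist x y * dist w y := by positivity
    have i5 := mul_le_mul_of_nonneg_right (hrR.trans ht₀.le) hr.le
    have i6 : δ * dist w y ≤ 4 * dist x y :=
      le_of_mul_le_mul_right (by nlinarith : δ * dist w y * D ≤ 4 * dist x y * D) hD
    have i7 : dist w y ≤ 4 / δ * dist x y := by
      rw [div_mul_eq_mul_div, le_div_iff₀' hδ]; exact i6
    have : (M - 1) * dist x y = 4 / δ * dist x y + dist x y := by simp only [M]; ring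
    linarith [dist_triangle w y x, dist_comm x y]
  have hfar : ∀ p : E, dist p x = R → p ∈ G ∧ dist x y ≤ boundaryDist G p := by
    intro p hp
    have hpw : ∀ w ∉ G, dist x y ≤ dist p w := fun w hw => by
      have : R = (M - 1) * dist x y + dist x y := by simp only [R]; ring
      linarith [dist_triangle p w x, hcompl w hw]
    refine ⟨by_contra fun hpG => ?_, (Metric.le_infDist hG.frontier_nonempty).2 fun {w} hw =>
      hpw w (hG.isOpen.frontier_eq ▸ hw : w ∈ closure G \ G).2⟩
    have := hpw p hpG
    rw [dist_self] at this
    linarith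
  have hin : ∀ p : E, dist p x ≤ R → x + (R / max R (dist p x)) • (p - x) = p := fun p hp => by
    rw [max_eq_left hp, div_self hR.ne', one_smul, add_sub_cancel]
  have hout : ∀ p : E, R < dist p x → dist (x + (R / max R (dist p x)) • (p - x)) x = R :=
    fun p hp => by
      have hp0 := hR.trans hp
      rw [max_eq_right hp.le, dist_eq_norm, add_sub_cancel_left, norm_smul, ← dist_eq_norm,
        Real.norm_of_nonneg (by positivity), div_mul_cancel₀ _ hp0.ne']
  refine ⟨(α.map (continuous_radialRetraction x hR)).cast (hin x (by simpa using hR.le)).symm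
    (hin y (by rwa [dist_comm])).symm, fun t => ?_⟩
  simp only [Path.cast_coe, Path.map_coe, Function.comp_apply]
  rcases le_or_gt (dist (α t) x) R with hle | hlt
  · rw [hin _ hle]
    exact ⟨hαG t, hle, hcig t⟩
  · have e := hout _ hlt
    obtain ⟨h1, h2⟩ := hfar _ e
    exact ⟨h1, e.le, (min_le_left _ _).trans
      (e.le.trans (mul_le_mul_of_nonneg_left h2 (by linarith)))⟩

/-- Joining points on dyadic spheres about `x` successively gives a curve to `x` each of whose
points is far from the boundary in comparison with the part of the curve between it and `x`. -/
lemma HasDistanceCigars.exists_path_dyadic (hG : IsProperDomain G) {C R : ℝ} (hC : 1 ≤ C)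
    (h : HasDistanceCigars C G) {x : E} (hx : x ∈ G)
    (hpts : ∀ ρ, 0 < ρ → ρ ≤ R → ∃ z ∈ G, dist z x = ρ ∧ ρ ≤ C * boundaryDist G z) (n : ℕ) :
    ∀ ρ, 0 < ρ → ρ ≤ R → 2 * ρ ≤ 2 ^ n * boundaryDist G x → ∀ z ∈ G, dist z x = ρ →
      ρ ≤ C * boundaryDist G z → ∃ γ : Path x z, (∀ t, γ t ∈ G ∧ dist (γ t) x ≤ 2 * C * ρ) ∧
        ∀ s t, s ≤ t → dist (γ s) x ≤ 8 * C ^ 3 * boundaryDist G (γ t) := by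
  have hC0 : 0 < C := by linarith
  induction n with
  | zero =>
    intro ρ hρ hρR hρx z hz hzx hzd
    obtain ⟨γ, hγ⟩ := exists_path_dist_le x z
    rw [dist_comm x z, hzx] at hγ
    rw [pow_zero, one_mul] at hρx
    refine ⟨γ, fun t => ⟨hG.mem_of_dist_lt hx ?_, (hγ t).trans ?_⟩, fun s t _ => (hγ s).trans ?_⟩
    · linarith [hγ t, dist_comm x (γ t)]
    · nlinarith
    · have h1 : ρ ≤ boundaryDist G (γ t) := by
        linarith [boundaryDist_le_add G x (γ t), hγ t, dist_comm x (γ t)]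
      have h2 : 1 ≤ C ^ 3 := one_le_pow₀ hC
      nlinarith
  | succ n ih =>
    intro ρ hρ hρR hρx z hz hzx hzd
    obtain ⟨w, hw, hwx, hwd⟩ := hpts (ρ / 2) (by linarith) (by linarith)
    obtain ⟨γ, hγ, hγd⟩ := ih (ρ / 2) (by linarith) (by linarith)
      (by rw [pow_succ] at hρx; linarith) w hw hwx hwd
    obtain ⟨η, hη⟩ := h.exists_path_far hC (ρ := ρ / 2 / C) hw hz
      ((div_le_iff₀' hC0).2 hwd) ((div_le_iff₀' hC0).2 (by linarith))
    have hηx : ∀ t, dist (η t) x ≤ 2 * C * ρ := fun t => by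
      have h1 : dist w z ≤ 3 / 2 * ρ := by linarith [dist_triangle_right w z x]
      have h2 := mul_le_mul_of_nonneg_left h1 hC0.le
      have h3 : ρ ≤ C * ρ := le_mul_of_one_le_left hρ.le hC
      linarith [dist_triangle (η t) w x, (hη t).2.1]
    have hηd : ∀ t, 2 * C * ρ ≤ 8 * C ^ 3 * boundaryDist G (η t) := fun t => by
      have := (hη t).2.2
      rw [div_le_iff₀ hC0] at this
      have := mul_le_mul_of_nonneg_left this hC0.le
      linarith
    have hγx : ∀ t, dist (γ t) x ≤ 2 * C * ρ := fun t => by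
      have := (hγ t).2
      have : 0 < C * ρ := by positivity
      linarith
    exact ⟨γ.trans η, Path.trans_forall (P := fun p => p ∈ G ∧ dist p x ≤ 2 * C * ρ) γ η
      (fun t => ⟨(hγ t).1, hγx t⟩) fun t => ⟨(hη t).1, hηx t⟩,
      Path.trans_forall_le (P := fun p q => dist p x ≤ 8 * C ^ 3 * boundaryDist G q) γ η
        hγd (fun s t _ => (hηx s).trans (hηd t)) fun s t => (hγx s).trans (hηd t)⟩

lemma HasDistanceCigars.isDiameterUniform (hG : IsProperDomain G) {C : ℝ} (hC : 1 ≤ C)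
    (h : HasDistanceCigars C G) : IsDiameterUniform (4 * (12 * C ^ 3) + 2) G := by
  have hC0 : 0 < C := by linarith
  intro x hx y hy hxy
  have hr : 0 < dist x y := dist_pos.2 hxy
  have half : ∀ {p q : E}, p ∈ G → q ∈ G → 0 < dist p q → ∃ z ∈ G,
      dist z p = dist p q / 2 ∧ dist p q / 2 / C ≤ boundaryDist G z ∧
      ∃ γ : Path p z, (∀ t, γ t ∈ G ∧ dist (γ t) p ≤ C * dist p q) ∧
        ∀ s t, s ≤ t → dist (γ s) p ≤ 8 * C ^ 3 * boundaryDist G (γ t) := by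
    intro p q hp hq hpq
    obtain ⟨z, hz, hzp, hzd⟩ := h.exists_mem_sphere hp hq (half_pos hpq) le_rfl
    have hd := hG.boundaryDist_pos hp
    obtain ⟨n, hn⟩ := pow_unbounded_of_one_lt (dist p q / boundaryDist G p) one_lt_two
    rw [div_lt_iff₀ hd] at hn
    obtain ⟨γ, hγ, hγd⟩ := h.exists_path_dyadic hG hC hp
      (fun ρ => h.exists_mem_sphere hp hq) n _ (half_pos hpq) le_rfl (by linarith) z hz hzp hzd
    exact ⟨z, hz, hzp, (div_le_iff₀' hC0).2 hzd, γ,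
      fun t => ⟨(hγ t).1, by linarith [(hγ t).2]⟩, hγd⟩
  obtain ⟨z, hz, hzx, hzd, γ, hγ, hγd⟩ := half hx hy hr
  obtain ⟨w, hw, hwy, hwd, β, hβ, hβd⟩ := half hy hx (by rwa [dist_comm])
  rw [dist_comm y x] at *
  obtain ⟨η, hη⟩ := h.exists_path_far hC hz hw hzd hwd
  have hCr : dist x y ≤ C * dist x y := le_mul_of_one_le_left hr.le hC
  have hηx : ∀ t, dist (η t) x ≤ 3 * (C * dist x y) := fun t => by
    have h1 : dist z w ≤ 2 * dist x y := by
      linarith [dist_triangle4 z x y w, dist_comm y w]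
    have h2 := mul_le_mul_of_nonneg_left h1 hC0.le
    linarith [dist_triangle (η t) z x, (hη t).2.1]
  have hηd : ∀ t, 3 * (C * dist x y) ≤ 12 * C ^ 3 * boundaryDist G (η t) := fun t => by
    have := (hη t).2.2
    rw [div_le_iff₀ hC0] at this
    have := mul_le_mul_of_nonneg_left this hC0.le
    linarith
  have hmono : ∀ p : E, 8 * C ^ 3 * boundaryDist G p ≤ 12 * C ^ 3 * boundaryDist G p := fun p => by
    have : 0 ≤ C ^ 3 * boundaryDist G p := mul_nonneg (by positivity) Metric.infDist_nonneg
    linarith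
  refine hG.exists_diameter_arc (by positivity) hxy ((γ.trans η).trans β.symm) ?_ ?_ ?_
  · exact Path.trans_forall (P := (· ∈ G)) _ _ (Path.trans_forall (P := (· ∈ G)) _ _
      (fun t => (hγ t).1) fun t => (hη t).1) fun t => (hβ _).1
  · refine Path.trans_symm_forall (P := fun p q => dist p x ≤ 12 * C ^ 3 * boundaryDist G q)
      (Q := fun p q => dist p y ≤ 12 * C ^ 3 * boundaryDist G q) _ _ ?_
      fun s t hst => (hβd s t hst).trans (hmono _)
    refine Path.trans_forall_le (P := fun p q => dist p x ≤ 12 * C ^ 3 * boundaryDist G q) _ _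
      (fun s t hst => (hγd s t hst).trans (hmono _)) (fun s t _ => (hηx s).trans (hηd t))
      fun s t => ?_
    linarith [(hγ s).2, hηd t]
  · have hC3 : 3 * (C * dist x y) ≤ 12 * C ^ 3 * dist x y := by
      have : C ^ 1 ≤ C ^ 3 := pow_le_pow_right₀ hC (by norm_num)
      nlinarith
    refine Path.trans_forall (P := fun p => dist p x ≤ 12 * C ^ 3 * dist x y) _ _
      (Path.trans_forall (P := fun p => dist p x ≤ 12 * C ^ 3 * dist x y) _ _
      (fun t => ?_) fun t => (hηx t).trans hC3) fun t => ?_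
    · linarith [(hγ t).2]
    · have := (hβ (σ t)).2
      change dist (β (σ t)) x ≤ _
      linarith [dist_triangle (β (σ t)) y x, dist_comm x y]

end Cigars

theorem theorem1p1 :
    (∀ c : ℝ, 1 ≤ c → ∃ c' : ℝ, 1 ≤ c' ∧
      ∀ (E : Type u) [NormedAddCommGroup E] [NormedSpace ℝ E] [CompleteSpace E],
        2 ≤ Module.rank ℝ E → ∀ G : Set E, IsProperDomain G →
          IsUniformDomain c G → HasMinMaxProperty c' G) ∧
    (∀ c' : ℝ, 1 ≤ c' → ∃ c₁ : ℝ, 1 ≤ c₁ ∧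
      ∀ (E : Type u) [NormedAddCommGroup E] [NormedSpace ℝ E] [CompleteSpace E],
        2 ≤ Module.rank ℝ E → ∀ G : Set E, IsProperDomain G →
          HasMinMaxProperty c' G → IsDiameterUniform c₁ G) ∧
    (∀ c₁ : ℝ, 1 ≤ c₁ → ∃ δ : ℝ, 0 < δ ∧ δ < 1 ∧
      ∀ (E : Type u) [NormedAddCommGroup E] [NormedSpace ℝ E] [CompleteSpace E],
        2 ≤ Module.rank ℝ E → ∀ G : Set E, IsProperDomain G →
          IsDiameterUniform c₁ G → IsCrossRatioUniform δ G) ∧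
    (∀ δ : ℝ, 0 < δ → δ < 1 → ∃ c₁ : ℝ, 1 ≤ c₁ ∧
      ∀ (E : Type u) [NormedAddCommGroup E] [NormedSpace ℝ E] [CompleteSpace E],
        2 ≤ Module.rank ℝ E → ∀ G : Set E, IsProperDomain G →
          IsCrossRatioUniform δ G → IsDiameterUniform c₁ G) := by
  refine ⟨fun c hc => ⟨1 + 2 * c * (1 + c), by nlinarith, fun E _ _ _ _ G _ h =>
      (h.isDiameterUniform (by linarith)).hasMinMaxProperty hc⟩,
    fun c hc => ⟨4 * (4 * c + 3) + 2, by linarith, fun E _ _ _ _ G hG h =>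
      h.isDiameterUniform hG hc⟩,
    fun c hc => ⟨1 / (c * (2 + c)), by positivity, ?_, fun E _ _ _ _ G hG h =>
      h.isCrossRatioUniform hG hc⟩,
    fun δ hδ hδ1 => ⟨4 * (12 * (4 / δ + 2) ^ 3) + 2, ?_, fun E _ _ _ _ G hG h =>
      (h.hasDistanceCigars hG hδ hδ1.le).isDiameterUniform hG ?_⟩⟩
  · rw [div_lt_one (by positivity)]
    nlinarith
  · have : 0 < (4 / δ + 2) ^ 3 := by positivity
    linarith
  · have : 0 < 4 / δ := by positivity
    linarith
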